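/- **Proposition 2.4 (Schur–Szegő).** For $A\subseteq\mathbb{C}$, call a polynomial $F\in\mathbb{C}[z]$ *$A$-nonvanishing* if either $F\equiv 0$ or $F(z)\neq 0$ for all $z\in A$. For real $\theta$ write $S[\theta]=\{z\in\mathbb{C}: z\neq 0,\ |\arg z|<\theta\}$, where $-\pi<\arg z\leq\pi$, and for $\kappa>0$ write $\kappa D=\{z\in\mathbb{C}:|z|<\kappa\}$ and $\kappa E=\{z\in\mathbb{C}:|z|>\kappa\}$. Let $d\geq 0$ be an integer, let $u_0,\dots,u_d\in\mathbb{C}$, let $P(z)=\sum_j c_jz^j\in\mathbb{C}[z]$ have degree at most $d$, and put $$K(z)=\sum_{j=0}^d\binom{d}{j}u_jz^j,\qquad Q(z)=\sum_{j=0}^d u_jc_jz^j.$$ (a) For every $0\leq\alpha<\pi/2$: if $P$ is $S[\pi/2]$-nonvanishing and $K$ is $S[\pi-\alpha]$-nonvanishing, then $Q$ is $S[\pi/2-\alpha]$-nonvanishing. (b) For all $\kappa>0$ and $\rho>0$: if $P$ is $\rho D$-nonvanishing and $K$ is $\kappa D$-nonvanishing, then $Q$ is $\kappa\rho D$-nonvanishing.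 (c) For all $\kappa>0$ and $\rho>0$: if $P$ is $\rho E$-nonvanishing, $K$ is $\kappa E$-nonvanishing, $\deg K=d$, and either $P\equiv 0$ or $\deg P=d$, then $Q$ is $\kappa\rho E$-nonvanishing. -/

import Mathlib

open Polynomial

namespace SchurSzego

/-- A complex polynomial in one variable is `A`-nonvanishing if it is identically zero or
has no zero in `A`. -/
def Nonvanishing (A : Set ℂ) (F : ℂ[X]) : Prop :=
  F = 0 ∨ ∀ z ∈ A, F.eval z ≠ 0

/-- The open sector `S[θ]` centred on the positive real axis
(`Complex.arg` takes values in `(-π, π]`). -/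
def sector (θ : ℝ) : Set ℂ :=
  {z | z ≠ 0 ∧ |Complex.arg z| < θ}

/-- The open disk `κD`. -/
def disk (κ : ℝ) : Set ℂ :=
  {z | ‖z‖ < κ}

/-- The open exterior `κE` of a disk. -/
def exterior (κ : ℝ) : Set ℂ :=
  {z | κ < ‖z‖}

/-- `K(z) = ∑_{j=0}^d (d choose j) u_j z^j`. -/
noncomputable def keyPolynomial (d : ℕ) (u : ℕ → ℂ) : ℂ[X] :=
  ∑ j ∈ Finset.range (d + 1), C ((d.choose j : ℂ) * u j) * X ^ j

/-- `Q(z) = ∑_{j=0}^d u_j c_j z^j`, where `P(z) = ∑_j c_j z^j`. -/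
noncomputable def composition (d : ℕ) (u : ℕ → ℂ) (P : ℂ[X]) : ℂ[X] :=
  ∑ j ∈ Finset.range (d + 1), C (u j * P.coeff j) * X ^ j

end SchurSzego

/-! `Q(z)` pairs the sequence `u_j z^j` with the coefficients of `P`, and the key polynomial of that
sequence is `w ↦ K(zw)`. Grace's theorem (`coeffPairing_ne_zero`) makes the pairing nonzero once
some convex circular region free of zeros of `K(zw)` contains `-1/r` for every root `r` of `P`. Its
proof strips off the roots of `P`: removing `r` replaces the key polynomial by a multiple of its
polar derivative at `-1/r`, still zero-free by Laguerre (`polarDerivative_eval_ne_zero`). A degree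
deficit counts as roots at infinity, so the region must then contain `0`.

For disks the region is `|zw| < κ`; exteriors become disks on reversing coefficients. For sectors it
is the right half-plane, which `z ∈ S[π/2-α]` multiplies into `S[π-α]`. As `0` lies only on its
boundary, `P` is perturbed to exact degree `d` with roots in `Re < 0`, and a Hurwitz limit recovers
`P`. -/

namespace SchurSzego

/-! ### Laguerre's theorem -/

/-- The Hermitian form whose positivity set `{w | 0 < circularForm A B C w}`, for `0 ≤ A`, is a
convex circular region: an open disk or an open half-plane. -/
noncomputable def circularForm (A : ℝ) (B : ℂ) (C : ℝ) (w : ℂ) : ℝ :=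
  C + 2 * (B * w).re - A * Complex.normSq w

/-- In the coordinate `y = 1/(w - r)`, with `w` in the region, the points `r` outside the region
fill a bounded convex set: the quadratic coefficient is `circularForm A B C w > 0`. -/
theorem normSq_mul_circularForm_sub_inv (A : ℝ) (B : ℂ) (C : ℝ) (w y : ℂ) (hy : y ≠ 0) :
    Complex.normSq y * circularForm A B C (w - y⁻¹) =
      circularForm A B C w * Complex.normSq y +
        (2 * (A * w - (starRingEnd ℂ) B) * y).re - A := by
  have hn : Complex.normSq y ≠ 0 := by simpa using hy
  rw [Complex.normSq_apply] at hn
  simp only [circularForm, Complex.normSq_apply, Complex.sub_re, Complex.sub_im, Complex.inv_re,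
    Complex.inv_im, Complex.mul_re, Complex.mul_im, Complex.conj_re, Complex.conj_im,
    Complex.ofReal_re, Complex.ofReal_im, Complex.re_ofNat, Complex.im_ofNat]
  generalize y.re = a at *
  generalize y.im = b at *
  have hn' : a ^ 2 + b ^ 2 ≠ 0 := by convert hn using 1; ring
  field_simp
  ring

/-- Tangent-plane inequality for the quadratic function `y ↦ g |y|² + Re (β y)`. -/
theorem quadratic_tangent_le {g : ℝ} (hg : 0 ≤ g) (β y Y : ℂ) :
    (((2 * g * (starRingEnd ℂ) Y + β)) * y).re - (((2 * g * (starRingEnd ℂ) Y + β)) * Y).re ≤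
      (g * Complex.normSq y + (β * y).re) - (g * Complex.normSq Y + (β * Y).re) := by
  have h := mul_nonneg hg (Complex.normSq_nonneg (y - Y))
  simp only [Complex.normSq_apply, Complex.sub_re, Complex.sub_im, Complex.mul_re, Complex.mul_im,
    Complex.conj_re, Complex.conj_im, Complex.ofReal_re, Complex.ofReal_im, Complex.re_ofNat,
    Complex.im_ofNat, Complex.add_re, Complex.add_im] at h ⊢
  linarith

/-- **Laguerre's theorem** for convex circular regions: the polar derivative of a polynomial
without zeros in the region has no zeros there either. -/
theorem polarDerivative_eval_ne_zero {A : ℝ} {B : ℂ} {C : ℝ} (hA : 0 ≤ A) {d : ℕ} {K : ℂ[X]}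
    (hd : K.natDegree ≤ d + 1) (hK : ∀ w, 0 < circularForm A B C w → K.eval w ≠ 0) {w w₀ : ℂ}
    (hw : 0 < circularForm A B C w) (hw₀ : 0 < circularForm A B C w₀) :
    (d + 1 : ℂ) * K.eval w + (w₀ - w) * K.derivative.eval w ≠ 0 := by
  intro h0
  have hKw := hK w hw
  have hd0 : (d + 1 : ℂ) ≠ 0 := by exact_mod_cast Nat.succ_ne_zero d
  by_cases hww : w - w₀ = 0
  · rw [← sub_eq_zero.1 hww] at h0
    simp_all
  have hsum := (IsAlgClosed.splits K).eval_derivative_div_eval_of_ne_zero hKw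
  set Y : ℂ := (w - w₀)⁻¹ with hYdef
  have hY0 : Y ≠ 0 := inv_ne_zero hww
  have hquot : K.derivative.eval w / K.eval w = (d + 1 : ℂ) * Y := by
    rw [hYdef]
    field_simp
    linear_combination -h0
  set g := circularForm A B C w
  set β : ℂ := 2 * (A * w - (starRingEnd ℂ) B) with hβ
  set γ : ℂ := 2 * g * (starRingEnd ℂ) Y + β
  -- Since `w - 1/Y = w₀` is in the region, `Y` lies strictly outside that convex set; the tangent
  -- functional `γ` at `Y` will separate them.
  have hYpos : 0 < g * Complex.normSq Y + (β * Y).re - A := by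
    rw [← normSq_mul_circularForm_sub_inv A B C w Y hY0]
    have : w - Y⁻¹ = w₀ := by simp [hYdef]
    rw [this]
    exact mul_pos (Complex.normSq_pos.2 hY0) hw₀
  -- The point `y = 0` represents a root at infinity; `0 ≤ A` places it in the convex set.
  have hzero : 0 < (γ * Y).re := by
    have := quadratic_tangent_le hw.le β 0 Y
    simp only [mul_zero, Complex.zero_re, map_zero] at this
    linarith
  have hroot : ∀ r ∈ K.roots, (γ * (1 / (w - r))).re < (γ * Y).re := by
    intro r hr
    have hr0 : K.eval r = 0 := (mem_roots'.1 hr).2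
    have hwr : w - r ≠ 0 := fun h => hKw (by rwa [sub_eq_zero.1 h])
    have hrneg : circularForm A B C r ≤ 0 := not_lt.1 fun h => hK r h hr0
    have key := normSq_mul_circularForm_sub_inv A B C w (1 / (w - r)) (one_div_ne_zero hwr)
    rw [one_div, inv_inv, sub_sub_cancel] at key
    have := quadratic_tangent_le hw.le β (w - r)⁻¹ Y
    have := mul_nonpos_of_nonneg_of_nonpos (Complex.normSq_nonneg (w - r)⁻¹) hrneg
    rw [one_div]
    linarith
  rw [hquot] at hsum
  have hre : (K.roots.map fun r => (γ * (1 / (w - r))).re).sum = (d + 1) * (γ * Y).re := by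
    have h1 : (γ * ((d + 1 : ℂ) * Y)).re = (d + 1) * (γ * Y).re := by
      rw [mul_left_comm]
      exact_mod_cast Complex.re_ofReal_mul (d + 1 : ℝ) (γ * Y)
    rw [← h1, hsum, ← Multiset.sum_map_mul_left]
    simpa [Multiset.map_map, Function.comp_def] using
      Multiset.sum_hom (K.roots.map fun r => γ * (1 / (w - r))) Complex.reAddGroupHom
  have hcard : (K.roots.card : ℝ) ≤ d + 1 := by
    exact_mod_cast (card_roots' K).trans hd
  rcases K.roots.empty_or_exists_mem with he | ⟨r, hr⟩
  · rw [he] at hre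
    have : (0 : ℝ) < (d + 1) * (γ * Y).re := by positivity
    rw [Multiset.map_zero, Multiset.sum_zero] at hre
    linarith
  -- At most `d + 1` terms, each below `Re (γ Y) > 0`, cannot add up to `(d + 1) Re (γ Y)`.
  · have hlt := Multiset.sum_lt_sum (fun r hr => (hroot r hr).le) ⟨r, hr, hroot r hr⟩
    rw [hre, Multiset.map_const', Multiset.sum_replicate, nsmul_eq_mul] at hlt
    nlinarith

/-! ### Grace's theorem by induction on the degree -/

/-- The bilinear pairing of a sequence with the coefficients of a polynomial of degree at most
`d`. -/
noncomputable def coeffPairing (d : ℕ) (u : ℕ → ℂ) (P : ℂ[X]) : ℂ :=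
  ∑ j ∈ Finset.range (d + 1), u j * P.coeff j

theorem coeffPairing_X_sub_C_mul {d : ℕ} (u : ℕ → ℂ) {P : ℂ[X]} (hP : P.natDegree ≤ d) (r : ℂ) :
    coeffPairing (d + 1) u ((X - C r) * P) =
      coeffPairing d (fun j => u (j + 1) - r * u j) P := by
  have h1 : ∀ j, ((X - C r) * P).coeff j = (X * P).coeff j - r * P.coeff j := by
    intro j; simp [sub_mul]
  have h2 : P.coeff (d + 1) = 0 := coeff_eq_zero_of_natDegree_lt (by omega)
  simp only [coeffPairing, h1]
  simp only [mul_sub, Finset.sum_sub_distrib, sub_mul]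
  rw [Finset.sum_range_succ' _ (d + 1),
    Finset.sum_range_succ (fun j : ℕ => u j * (r * P.coeff j)) (d + 1)]
  simp only [coeff_X_mul, h2, coeff_X_mul_zero, mul_zero, add_zero]
  congr 1
  exact Finset.sum_congr rfl fun j _ => by ring

theorem keyPolynomial_eval (d : ℕ) (u : ℕ → ℂ) (w : ℂ) :
    (keyPolynomial d u).eval w = ∑ j ∈ Finset.range (d + 1), (d.choose j : ℂ) * u j * w ^ j := by
  simp [keyPolynomial, eval_finsetSum]

theorem keyPolynomial_coeff (d : ℕ) (u : ℕ → ℂ) {j : ℕ} (hj : j ≤ d) :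
    (keyPolynomial d u).coeff j = (d.choose j : ℂ) * u j := by
  simp only [keyPolynomial, finsetSum_coeff, coeff_C_mul_X_pow]
  rw [Finset.sum_ite_eq, if_pos (Finset.mem_range_succ_iff.2 hj)]

theorem keyPolynomial_natDegree_le (d : ℕ) (u : ℕ → ℂ) : (keyPolynomial d u).natDegree ≤ d :=
  natDegree_sum_le_of_forall_le _ _ fun _ hj =>
    (natDegree_C_mul_X_pow_le _ _).trans (Finset.mem_range_succ_iff.1 hj)

theorem keyPolynomial_eval_succ (d : ℕ) (u : ℕ → ℂ) (w : ℂ) :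
    (keyPolynomial (d + 1) u).eval w =
      (keyPolynomial d u).eval w + w * (keyPolynomial d fun j => u (j + 1)).eval w := by
  simp only [keyPolynomial_eval]
  rw [Finset.sum_range_succ', Finset.mul_sum,
    Finset.sum_range_succ' (fun j => (d.choose j : ℂ) * u j * w ^ j)]
  have h : ∑ j ∈ Finset.range d, (d.choose (j + 1) : ℂ) * u (j + 1) * w ^ (j + 1) =
      ∑ j ∈ Finset.range (d + 1), (d.choose (j + 1) : ℂ) * u (j + 1) * w ^ (j + 1) := by
    rw [Finset.sum_range_succ, Nat.choose_succ_self]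
    simp
  rw [h]
  simp only [Nat.choose_zero_right]
  rw [add_right_comm, ← Finset.sum_add_distrib]
  congr 1
  refine Finset.sum_congr rfl fun j _ => ?_
  rw [Nat.choose_succ_succ]
  push_cast
  ring

theorem keyPolynomial_derivative_eval (d : ℕ) (u : ℕ → ℂ) (w : ℂ) :
    (keyPolynomial (d + 1) u).derivative.eval w =
      (d + 1 : ℂ) * (keyPolynomial d fun j => u (j + 1)).eval w := by
  rw [keyPolynomial_eval, keyPolynomial, derivative_sum, eval_finsetSum, Finset.sum_range_succ',
    Finset.mul_sum]
  simp only [derivative_C_mul_X_pow, eval_C_mul, eval_pow, eval_X]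
  simp only [Nat.cast_zero, mul_zero, zero_mul, add_zero]
  refine Finset.sum_congr rfl fun j _ => ?_
  have h : ((d + 1 : ℕ) : ℂ) * d.choose j = (d + 1).choose (j + 1) * (j + 1 : ℕ) := by
    exact_mod_cast Nat.add_one_mul_choose_eq d j
  push_cast at h ⊢
  linear_combination -u (j + 1) * w ^ j * h

theorem keyPolynomial_add_smul_eval (d : ℕ) (u v : ℕ → ℂ) (a b w : ℂ) :
    (keyPolynomial d fun j => a * u j + b * v j).eval w =
      a * (keyPolynomial d u).eval w + b * (keyPolynomial d v).eval w := by
  simp only [keyPolynomial_eval, Finset.mul_sum, ← Finset.sum_add_distrib]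
  exact Finset.sum_congr rfl fun j _ => by ring

/-- By Pascal's rule and the derivative formula, the expression is the polar derivative at `w₀`
divided by `d + 1`. -/
theorem keyPolynomial_polar_eval_ne_zero {A : ℝ} {B : ℂ} {C : ℝ} (hA : 0 ≤ A) {d : ℕ}
    {u : ℕ → ℂ} (hK : ∀ w, 0 < circularForm A B C w → (keyPolynomial (d + 1) u).eval w ≠ 0)
    {w w₀ : ℂ} (hw : 0 < circularForm A B C w) (hw₀ : 0 < circularForm A B C w₀) :
    (keyPolynomial d u).eval w + w₀ * (keyPolynomial d fun j => u (j + 1)).eval w ≠ 0 := by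
  intro h
  refine polarDerivative_eval_ne_zero hA (keyPolynomial_natDegree_le _ _) hK hw hw₀ ?_
  rw [keyPolynomial_derivative_eval, keyPolynomial_eval_succ]
  linear_combination (d + 1 : ℂ) * h

/-- **Grace–Walsh–Szegő theorem** for convex circular regions, with the point of the polarized
form given through the roots `r` of a polynomial, as `-1 / r`. -/
theorem coeffPairing_ne_zero {A : ℝ} {B : ℂ} {C : ℝ} (hA : 0 ≤ A) {d : ℕ} {u : ℕ → ℂ} {P : ℂ[X]}
    (hK : ∀ w, 0 < circularForm A B C w → (keyPolynomial d u).eval w ≠ 0) (hP0 : P ≠ 0)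
    (hd : P.natDegree = d ∨ P.natDegree ≤ d ∧ 0 < circularForm A B C 0)
    (hP : ∀ r, P.eval r = 0 → r ≠ 0 ∧ 0 < circularForm A B C (-r⁻¹))
    (hne : ∃ w, 0 < circularForm A B C w) :
    coeffPairing d u P ≠ 0 := by
  induction d generalizing u P with
  | zero =>
    obtain ⟨w, hw⟩ := hne
    have hu := hK w hw
    have hdeg : P.natDegree = 0 := by omega
    rw [eq_C_of_natDegree_eq_zero hdeg] at hP0 ⊢
    rw [keyPolynomial_eval] at hu
    simp_all [coeffPairing]
  | succ d ih =>
    by_cases hdeg : P.natDegree = d + 1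
    · obtain ⟨r, hr⟩ := Complex.exists_root
        (natDegree_pos_iff_degree_pos.1 (by omega : 0 < P.natDegree))
      obtain ⟨P', rfl⟩ := dvd_iff_isRoot.2 hr
      have hP'0 : P' ≠ 0 := right_ne_zero_of_mul hP0
      have hdeg' : P'.natDegree = d := by
        rw [natDegree_mul (X_sub_C_ne_zero r) hP'0, natDegree_X_sub_C] at hdeg
        omega
      obtain ⟨hr0, hrA⟩ := hP r hr
      rw [coeffPairing_X_sub_C_mul u hdeg'.le]
      refine ih (fun w hw h => ?_) hP'0 (Or.inl hdeg') fun s hs => hP s (by simp [hs])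
      have := keyPolynomial_add_smul_eval d (fun j => u (j + 1)) u 1 (-r) w
      simp only [one_mul, neg_mul, ← sub_eq_add_neg] at this
      rw [this] at h
      -- The new key polynomial is `-r` times the polar derivative at `w₀ = -1/r`.
      refine keyPolynomial_polar_eval_ne_zero hA hK hw hrA ?_
      field_simp
      linear_combination -h
    · obtain ⟨hle, h0⟩ : P.natDegree ≤ d ∧ 0 < circularForm A B C 0 := by
        rcases hd with h | h
        · exact absurd h hdeg
        · exact ⟨by omega, h.2⟩
      have hz : P.coeff (d + 1) = 0 := coeff_eq_zero_of_natDegree_lt (by omega)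
      have : coeffPairing (d + 1) u P = coeffPairing d u P := by
        simp [coeffPairing, Finset.sum_range_succ _ (d + 1), hz]
      rw [this]
      refine ih (fun w hw => ?_) hP0 (Or.inr ⟨hle, h0⟩) hP
      -- A root at infinity corresponds to `w₀ = 0`.
      simpa using keyPolynomial_polar_eval_ne_zero hA hK hw h0

/-! ### The composition as a pairing; disks -/

theorem composition_eval (d : ℕ) (u : ℕ → ℂ) (P : ℂ[X]) (z : ℂ) :
    (composition d u P).eval z = coeffPairing d (fun j => u j * z ^ j) P := by
  simp only [composition, coeffPairing, eval_finsetSum, eval_mul, eval_C, eval_pow, eval_X]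
  exact Finset.sum_congr rfl fun j _ => by ring

theorem keyPolynomial_mul_pow_eval (d : ℕ) (u : ℕ → ℂ) (z w : ℂ) :
    (keyPolynomial d fun j => u j * z ^ j).eval w = (keyPolynomial d u).eval (z * w) := by
  simp only [keyPolynomial_eval]
  exact Finset.sum_congr rfl fun j _ => by ring

theorem composition_zero_right (d : ℕ) (u : ℕ → ℂ) : composition d u 0 = 0 := by
  simp [composition]

theorem composition_eq_zero_of_keyPolynomial_eq_zero {d : ℕ} {u : ℕ → ℂ}
    (h : keyPolynomial d u = 0) (P : ℂ[X]) : composition d u P = 0 := by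
  refine Finset.sum_eq_zero fun j hj => ?_
  have hj' := Finset.mem_range_succ_iff.1 hj
  have hc := keyPolynomial_coeff d u hj'
  have : (d.choose j : ℂ) ≠ 0 := by exact_mod_cast (Nat.choose_pos hj').ne'
  rw [h, coeff_zero] at hc
  simp [(mul_eq_zero.1 hc.symm).resolve_left this]

/-- The Schur–Szegő composition theorem for disks. -/
theorem nonvanishing_disk_composition {d : ℕ} {u : ℕ → ℂ} {P : ℂ[X]} (hd : P.natDegree ≤ d)
    {κ ρ : ℝ} (hκ : 0 < κ) (hρ : 0 < ρ) (hP : Nonvanishing (disk ρ) P)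
    (hK : Nonvanishing (disk κ) (keyPolynomial d u)) :
    Nonvanishing (disk (κ * ρ)) (composition d u P) := by
  rcases hP with rfl | hP
  · exact Or.inl (composition_zero_right d u)
  rcases hK with hK | hK
  · exact Or.inl (composition_eq_zero_of_keyPolynomial_eq_zero hK P)
  have h00 : P.eval 0 ≠ 0 := hP 0 (by simpa [disk] using hρ)
  refine Or.inr fun z hz => ?_
  have hform : ∀ w, 0 < circularForm (‖z‖ ^ 2) 0 (κ ^ 2) w ↔ ‖z * w‖ < κ := by
    intro w
    rw [← sq_lt_sq₀ (norm_nonneg _) hκ.le, norm_mul, mul_pow, circularForm, Complex.normSq_eq_norm_sq]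
    simp
  rw [composition_eval]
  refine coeffPairing_ne_zero (A := ‖z‖ ^ 2) (B := 0) (C := κ ^ 2) (by positivity)
    (fun w hw => ?_) (fun h => h00 (by simp [h])) (Or.inr ⟨hd, (hform 0).2 (by simpa)⟩)
    (fun r hr => ?_) ⟨0, (hform 0).2 (by simpa)⟩
  · rw [keyPolynomial_mul_pow_eval]
    exact hK _ ((hform w).1 hw)
  · have hr0 : r ≠ 0 := by rintro rfl; exact h00 hr
    refine ⟨hr0, (hform _).2 ?_⟩
    have hrρ : ρ ≤ ‖r‖ := not_lt.1 fun h => hP r h hr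
    have hz' : ‖z‖ < κ * ρ := hz
    rw [norm_mul, norm_neg, norm_inv, ← div_eq_mul_inv, div_lt_iff₀ (by positivity)]
    nlinarith

/-! ### Exteriors of disks by reversal -/

/-- Inversion `z ↦ 1/z` exchanges the regions except for the centre `0`, where the reversed
polynomial takes the leading coefficient as its value; hence the exact degree. -/
theorem nonvanishing_disk_reflect_iff {d : ℕ} {F : ℂ[X]} (hd : F.natDegree = d) {κ : ℝ}
    (hκ : 0 < κ) : Nonvanishing (disk κ⁻¹) (F.reflect d) ↔ Nonvanishing (exterior κ) F := by
  have hdis : ∀ z : ℂ, z ≠ 0 → (F.reflect d).eval z⁻¹ * z ^ d = F.eval z := by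
    intro z hz
    have := invertibleOfNonzero hz
    simpa [invOf_eq_inv, eval₂_eq_eval_map] using eval₂_reflect_mul_pow (RingHom.id ℂ) z d F hd.le
  unfold Nonvanishing
  by_cases hF : F = 0
  · simp [hF]
  simp only [hF, reflect_eq_zero_iff, false_or]
  constructor
  · intro h z hz
    have hz' : κ < ‖z‖ := hz
    have hz0 : z ≠ 0 := norm_pos_iff.1 (hκ.trans hz')
    rw [← hdis z hz0]
    refine mul_ne_zero (h _ ?_) (pow_ne_zero _ hz0)
    simpa [disk] using inv_strictAnti₀ hκ hz'
  · intro h z hz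
    by_cases hz0 : z = 0
    · rw [hz0, ← coeff_zero_eq_eval_zero, coeff_reflect, revAt_le (Nat.zero_le d), Nat.sub_zero,
        ← hd]
      exact leadingCoeff_ne_zero.2 hF
    · have hz' : ‖z‖ < κ⁻¹ := hz
      intro h0
      refine h z⁻¹ ?_ (by rw [← hdis _ (inv_ne_zero hz0), inv_inv, h0, zero_mul])
      have := inv_strictAnti₀ (norm_pos_iff.2 hz0) hz'
      simpa [exterior] using this

theorem reflect_keyPolynomial (d : ℕ) (u : ℕ → ℂ) :
    (keyPolynomial d u).reflect d = keyPolynomial d fun j => u (d - j) := by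
  ext j
  rcases le_or_gt j d with hj | hj
  · rw [coeff_reflect, revAt_le hj, keyPolynomial_coeff _ _ (Nat.sub_le d j),
      keyPolynomial_coeff _ _ hj, Nat.choose_symm hj]
  · rw [coeff_reflect, revAt_eq_self_of_lt hj,
      coeff_eq_zero_of_natDegree_lt ((keyPolynomial_natDegree_le _ _).trans_lt hj),
      coeff_eq_zero_of_natDegree_lt ((keyPolynomial_natDegree_le _ _).trans_lt hj)]

theorem composition_coeff (d : ℕ) (u : ℕ → ℂ) (P : ℂ[X]) {j : ℕ} (hj : j ≤ d) :
    (composition d u P).coeff j = u j * P.coeff j := by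
  simp only [composition, finsetSum_coeff, coeff_C_mul_X_pow]
  rw [Finset.sum_ite_eq, if_pos (Finset.mem_range_succ_iff.2 hj)]

theorem composition_natDegree_le (d : ℕ) (u : ℕ → ℂ) (P : ℂ[X]) :
    (composition d u P).natDegree ≤ d :=
  natDegree_sum_le_of_forall_le _ _ fun _ hj =>
    (natDegree_C_mul_X_pow_le _ _).trans (Finset.mem_range_succ_iff.1 hj)

theorem reflect_composition (d : ℕ) (u : ℕ → ℂ) (P : ℂ[X]) :
    (composition d u P).reflect d = composition d (fun j => u (d - j)) (P.reflect d) := by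
  ext j
  rcases le_or_gt j d with hj | hj
  · rw [coeff_reflect, revAt_le hj, composition_coeff _ _ _ (Nat.sub_le d j),
      composition_coeff _ _ _ hj, coeff_reflect, revAt_le hj]
  · rw [coeff_reflect, revAt_eq_self_of_lt hj,
      coeff_eq_zero_of_natDegree_lt ((composition_natDegree_le _ _ _).trans_lt hj),
      coeff_eq_zero_of_natDegree_lt ((composition_natDegree_le _ _ _).trans_lt hj)]

/-- The Schur–Szegő composition theorem for exteriors of disks. -/
theorem nonvanishing_exterior_composition {d : ℕ} {u : ℕ → ℂ} {P : ℂ[X]}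
    (hd : P.natDegree = d) (hKd : (keyPolynomial d u).natDegree = d)
    {κ ρ : ℝ} (hκ : 0 < κ) (hρ : 0 < ρ) (hP : Nonvanishing (exterior ρ) P)
    (hK : Nonvanishing (exterior κ) (keyPolynomial d u)) :
    Nonvanishing (exterior (κ * ρ)) (composition d u P) := by
  by_cases hP0 : P = 0
  · rw [hP0]; exact Or.inl (composition_zero_right d u)
  by_cases hK0 : keyPolynomial d u = 0
  · exact Or.inl (composition_eq_zero_of_keyPolynomial_eq_zero hK0 P)
  have hQd : (composition d u P).natDegree = d := by
    refine natDegree_eq_of_le_of_coeff_ne_zero (composition_natDegree_le d u P) ?_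
    rw [composition_coeff _ _ _ le_rfl]
    have h1 := leadingCoeff_ne_zero.2 hP0
    have h2 := leadingCoeff_ne_zero.2 hK0
    rw [leadingCoeff, hd] at h1
    rw [leadingCoeff, hKd, keyPolynomial_coeff _ _ le_rfl] at h2
    exact mul_ne_zero (right_ne_zero_of_mul h2) h1
  rw [← nonvanishing_disk_reflect_iff hQd (mul_pos hκ hρ), reflect_composition, mul_inv]
  rw [← nonvanishing_disk_reflect_iff hd hρ] at hP
  rw [← nonvanishing_disk_reflect_iff hKd hκ, reflect_keyPolynomial] at hK
  refine nonvanishing_disk_composition ?_ (inv_pos.2 hκ) (inv_pos.2 hρ) hP hK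
  exact natDegree_le_iff_coeff_eq_zero.2 fun N hN => by
    rw [coeff_reflect, revAt_eq_self_of_lt hN, coeff_eq_zero_of_natDegree_lt (by omega)]

/-! ### Hurwitz's theorem without complex analysis -/

/-- A polynomial without zeros in a ball is controlled on the half ball by its value at the
centre. -/
theorem norm_eval_le_of_forall_ball_ne_zero {F : ℂ[X]} {z₀ z : ℂ} {δ : ℝ}
    (hF : ∀ r ∈ Metric.ball z₀ δ, F.eval r ≠ 0) (hz : ‖z - z₀‖ ≤ δ / 2) :
    ‖F.eval z‖ ≤ (3 / 2 : ℝ) ^ F.natDegree * ‖F.eval z₀‖ := by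
  have hs := IsAlgClosed.splits F
  have key : ∀ s : Multiset ℂ, (∀ r ∈ s, r ∉ Metric.ball z₀ δ) →
      ‖(s.map fun r => z - r).prod‖ ≤
        (3 / 2 : ℝ) ^ Multiset.card s * ‖(s.map fun r => z₀ - r).prod‖ := by
    intro s
    induction s using Multiset.induction_on with
    | empty => simp
    | cons r s ih =>
      intro h
      have ih := ih fun r hr => h r (Multiset.mem_cons_of_mem hr)
      have hr : δ ≤ ‖z₀ - r‖ := by
        have := h r (Multiset.mem_cons_self r s)
        rwa [Metric.mem_ball, dist_comm, dist_eq_norm, not_lt] at this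
      -- Here `‖z - z₀‖ ≤ δ/2 ≤ ‖z₀ - r‖/2`.
      have h1 : ‖z - r‖ ≤ 3 / 2 * ‖z₀ - r‖ := by
        have := norm_add_le (z - z₀) (z₀ - r)
        rw [sub_add_sub_cancel] at this
        linarith
      simp only [Multiset.map_cons, Multiset.prod_cons, norm_mul, Multiset.card_cons, pow_succ]
      calc _ ≤ (3 / 2 * ‖z₀ - r‖) *
            ((3 / 2 : ℝ) ^ Multiset.card s * ‖(s.map fun r => z₀ - r).prod‖) := by gcongr
        _ = _ := by ring
  rw [hs.eval_eq_prod_roots, hs.eval_eq_prod_roots, norm_mul, norm_mul, mul_left_comm]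
  refine mul_le_mul_of_nonneg_left ?_ (norm_nonneg _)
  refine (key F.roots fun r hr hb => hF r hb (mem_roots'.1 hr).2).trans ?_
  gcongr
  · norm_num
  · exact card_roots' F

/-- A Hurwitz theorem for polynomials of bounded degree. -/
theorem Nonvanishing.of_tendsto {ι : Type*} {l : Filter ι} [l.NeBot] {d : ℕ} {F : ι → ℂ[X]}
    {G : ℂ[X]} {U : Set ℂ} (hU : IsOpen U) (hd : ∀ i, (F i).natDegree ≤ d)
    (hF : ∀ᶠ i in l, ∀ z ∈ U, (F i).eval z ≠ 0)
    (hlim : ∀ z, Filter.Tendsto (fun i => (F i).eval z) l (nhds (G.eval z))) :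
    Nonvanishing U G := by
  by_contra hcon
  simp only [Nonvanishing, not_or, not_forall, not_not] at hcon
  obtain ⟨hG, z₀, hz₀, hGz⟩ := hcon
  obtain ⟨δ, hδ, hball⟩ := Metric.isOpen_iff.1 hU z₀ hz₀
  refine hG (eq_zero_of_infinite_isRoot G ?_)
  refine Set.Infinite.mono (s := Metric.ball z₀ (δ / 2)) (fun z hz => ?_)
    (infinite_of_mem_nhds z₀ (Metric.ball_mem_nhds z₀ (by positivity)))
  -- The degree bound makes the constant uniform, so the estimate survives the limit and `G`
  -- vanishes on a whole ball.
  have hle : ‖G.eval z‖ ≤ (3 / 2 : ℝ) ^ d * ‖G.eval z₀‖ := by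
    refine le_of_tendsto_of_tendsto (hlim z).norm ((hlim z₀).norm.const_mul _) ?_
    filter_upwards [hF] with i hi
    refine (norm_eval_le_of_forall_ball_ne_zero (fun r hr => hi r (hball hr))
      (by rw [← dist_eq_norm]; exact (Metric.mem_ball.1 hz).le)).trans ?_
    gcongr
    · norm_num
    · exact hd i
  simpa [hGz] using hle

/-! ### Sectors and perturbation -/

theorem isOpen_sector {θ : ℝ} (hθ : θ ≤ Real.pi) : IsOpen (sector θ) := by
  rw [isOpen_iff_mem_nhds]
  rintro z ⟨hz0, hz⟩
  have hslit : z ∈ Complex.slitPlane :=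
    Complex.mem_slitPlane_iff_arg.2 ⟨fun h => by rw [h, abs_of_pos Real.pi_pos] at hz; linarith, hz0⟩
  have hc : ContinuousAt (fun w => |Complex.arg w|) z := (Complex.continuousAt_arg hslit).abs
  filter_upwards [isOpen_ne.mem_nhds hz0, hc.eventually_lt_const hz] with w h1 h2
  exact ⟨h1, h2⟩

/-- The bound by `π` prevents the sum of the arguments from wrapping around. -/
theorem mul_mem_sector {θ φ : ℝ} (h : θ + φ ≤ Real.pi) {z w : ℂ} (hz : z ∈ sector θ)
    (hw : w ∈ sector φ) : z * w ∈ sector (θ + φ) := by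
  obtain ⟨hz0, hz⟩ := hz
  obtain ⟨hw0, hw⟩ := hw
  refine ⟨mul_ne_zero hz0 hw0, ?_⟩
  have hlt := (abs_add_le z.arg w.arg).trans_lt (add_lt_add hz hw)
  have hmem := abs_lt.1 (hlt.trans_le h)
  rwa [Complex.arg_mul hz0 hw0 ⟨hmem.1, hmem.2.le⟩]

theorem mem_sector_pi_div_two {z : ℂ} : z ∈ sector (Real.pi / 2) ↔ 0 < z.re := by
  simp only [sector, Set.mem_ofPred_eq, Complex.abs_arg_lt_pi_div_two_iff]
  constructor
  · rintro ⟨h0, h | h⟩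
    · exact h
    · exact absurd h h0
  · exact fun h => ⟨fun h0 => by simp [h0] at h, Or.inl h⟩

theorem composition_eval_ne_zero_of_stable {d : ℕ} {u : ℕ → ℂ} {P : ℂ[X]} (hP0 : P ≠ 0)
    (hd : P.natDegree = d) (hP : ∀ r, P.eval r = 0 → r.re < 0) {α : ℝ} (hα : 0 ≤ α)
    (hK : ∀ z ∈ sector (Real.pi - α), (keyPolynomial d u).eval z ≠ 0) {z : ℂ}
    (hz : z ∈ sector (Real.pi / 2 - α)) : (composition d u P).eval z ≠ 0 := by
  have hform : ∀ w, 0 < circularForm 0 1 0 w ↔ 0 < w.re := by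
    intro w; simp [circularForm]
  rw [composition_eval]
  refine coeffPairing_ne_zero (A := 0) (B := 1) (C := 0) le_rfl (fun w hw => ?_) hP0 (Or.inl hd)
    (fun r hr => ?_) ⟨1, by simp [hform]⟩
  · rw [keyPolynomial_mul_pow_eval]
    have := mul_mem_sector (by linarith) hz (mem_sector_pi_div_two.2 ((hform w).1 hw))
    refine hK _ ?_
    convert this using 2
    ring
  · have hr' := hP r hr
    have hr0 : r ≠ 0 := by rintro rfl; simp at hr'
    refine ⟨hr0, (hform _).2 ?_⟩
    rw [Complex.neg_re, Complex.inv_re, ← neg_div]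
    exact div_pos (by linarith) (Complex.normSq_pos.2 hr0)

theorem continuous_coeff_mul {T : Type*} [TopologicalSpace T] {F G : T → ℂ[X]}
    (hF : ∀ j, Continuous fun t => (F t).coeff j) (hG : ∀ j, Continuous fun t => (G t).coeff j)
    (j : ℕ) : Continuous fun t => (F t * G t).coeff j := by
  simp only [coeff_mul]
  exact continuous_finsetSum _ fun x _ => (hF x.1).mul (hG x.2)

theorem continuous_coeff_pow {T : Type*} [TopologicalSpace T] {F : T → ℂ[X]}
    (hF : ∀ j, Continuous fun t => (F t).coeff j) (n j : ℕ) :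
    Continuous fun t => (F t ^ n).coeff j := by
  induction n generalizing j with
  | zero => simpa using continuous_const
  | succ n ih => simpa only [pow_succ] using continuous_coeff_mul ih hF j

/-- A perturbation of `P` of exact degree `d`, all of whose zeros have negative real part when
`P` has no zeros of positive real part. -/
noncomputable def stablePerturbation (d : ℕ) (P : ℂ[X]) (ε : ℝ) : ℂ[X] :=
  (C (ε : ℂ) * X + 1) ^ (d - P.natDegree) * taylor (ε : ℂ) P

theorem continuous_stablePerturbation_coeff (d : ℕ) (P : ℂ[X]) (j : ℕ) :
    Continuous fun ε => (stablePerturbation d P ε).coeff j := by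
  refine continuous_coeff_mul (continuous_coeff_pow (fun i => ?_) _) (fun i => ?_) j
  · simp only [coeff_add, coeff_C_mul]
    fun_prop
  · simp only [taylor_coeff]
    fun_prop

theorem stablePerturbation_zero (d : ℕ) (P : ℂ[X]) : stablePerturbation d P 0 = P := by
  simp [stablePerturbation]

theorem stablePerturbation_natDegree {d : ℕ} {P : ℂ[X]} (hP : P ≠ 0) (hd : P.natDegree ≤ d)
    {ε : ℝ} (hε : ε ≠ 0) : (stablePerturbation d P ε).natDegree = d := by
  have hdeg : (C (ε : ℂ) * X + 1).natDegree = 1 := by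
    rw [← C_1]; exact natDegree_linear (by exact_mod_cast hε)
  have h1 : C (ε : ℂ) * X + 1 ≠ 0 := by rintro h; simp [h] at hdeg
  rw [stablePerturbation, natDegree_mul (pow_ne_zero _ h1)
    (by rwa [Ne, taylor_eq_zero]), natDegree_pow, hdeg,
    natDegree_taylor]
  omega

theorem re_neg_of_stablePerturbation_eval_eq_zero {d : ℕ} {P : ℂ[X]}
    (hP : ∀ z : ℂ, 0 < z.re → P.eval z ≠ 0) {ε : ℝ} (hε : 0 < ε) {r : ℂ}
    (hr : (stablePerturbation d P ε).eval r = 0) : r.re < 0 := by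
  rw [stablePerturbation, eval_mul, mul_eq_zero] at hr
  by_contra! hre
  rcases hr with hr | hr
  · rw [eval_pow] at hr
    have h := congrArg Complex.re (eq_zero_of_pow_eq_zero hr)
    simp at h
    nlinarith
  · rw [taylor_eval] at hr
    exact hP _ (by simp; linarith) hr

/-- The Schur–Szegő composition theorem for sectors. -/
theorem nonvanishing_sector_composition {d : ℕ} {u : ℕ → ℂ} {P : ℂ[X]} (hd : P.natDegree ≤ d)
    {α : ℝ} (hα : 0 ≤ α) (hP : Nonvanishing (sector (Real.pi / 2)) P)
    (hK : Nonvanishing (sector (Real.pi - α)) (keyPolynomial d u)) :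
    Nonvanishing (sector (Real.pi / 2 - α)) (composition d u P) := by
  by_cases hP0 : P = 0
  · rw [hP0]; exact Or.inl (composition_zero_right d u)
  rcases hK with hK | hK
  · exact Or.inl (composition_eq_zero_of_keyPolynomial_eq_zero hK P)
  have hP' : ∀ z : ℂ, 0 < z.re → P.eval z ≠ 0 := fun z hz =>
    hP.resolve_left hP0 z (mem_sector_pi_div_two.2 hz)
  refine Nonvanishing.of_tendsto (l := nhdsWithin (0 : ℝ) (Set.Ioi 0))
    (F := fun ε => composition d u (stablePerturbation d P ε))
    (isOpen_sector (by linarith [Real.pi_pos])) (fun _ => composition_natDegree_le _ _ _) ?_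
    fun z => ?_
  · filter_upwards [self_mem_nhdsWithin] with ε hε z hz
    have hε : 0 < ε := hε
    have hdeg := stablePerturbation_natDegree hP0 hd hε.ne'
    have hne : stablePerturbation d P ε ≠ 0 := by
      intro h
      -- A zero polynomial would have the root `0`, whose real part is not negative.
      have := re_neg_of_stablePerturbation_eval_eq_zero (d := d) hP' hε (r := 0) (by simp [h])
      simp at this
    exact composition_eval_ne_zero_of_stable hne hdeg
      (fun r hr => re_neg_of_stablePerturbation_eval_eq_zero hP' hε hr) hα hK hz
  · have hc : Continuous fun ε : ℝ => (composition d u (stablePerturbation d P ε)).eval z := by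
      simp only [composition_eval, coeffPairing]
      exact continuous_finsetSum _ fun j _ =>
        continuous_const.mul (continuous_stablePerturbation_coeff d P j)
    have := hc.tendsto 0
    rw [stablePerturbation_zero] at this
    exact this.mono_left nhdsWithin_le_nhds

end SchurSzego


theorem proposition2p4 (d : ℕ) (u : ℕ → ℂ) (P K Q : Polynomial ℂ)
    (hP : P.natDegree ≤ d)
    (hK : K = SchurSzego.keyPolynomial d u)
    (hQ : Q = SchurSzego.composition d u P) :
    (∀ α : ℝ, 0 ≤ α → α < Real.pi / 2 →
      SchurSzego.Nonvanishing (SchurSzego.sector (Real.pi / 2)) P →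
      SchurSzego.Nonvanishing (SchurSzego.sector (Real.pi - α)) K →
      SchurSzego.Nonvanishing (SchurSzego.sector (Real.pi / 2 - α)) Q) ∧
    (∀ κ ρ : ℝ, 0 < κ → 0 < ρ →
      SchurSzego.Nonvanishing (SchurSzego.disk ρ) P →
      SchurSzego.Nonvanishing (SchurSzego.disk κ) K →
      SchurSzego.Nonvanishing (SchurSzego.disk (κ * ρ)) Q) ∧
    (∀ κ ρ : ℝ, 0 < κ → 0 < ρ →
      SchurSzego.Nonvanishing (SchurSzego.exterior ρ) P →
      SchurSzego.Nonvanishing (SchurSzego.exterior κ) K →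
      (P = 0 ∨ P.natDegree = d) →
      K.natDegree = d →
      SchurSzego.Nonvanishing (SchurSzego.exterior (κ * ρ)) Q) := by
  subst hK hQ
  refine ⟨fun α hα _ hP' hK => SchurSzego.nonvanishing_sector_composition hP hα hP' hK,
    fun κ ρ hκ hρ hP' hK => SchurSzego.nonvanishing_disk_composition hP hκ hρ hP' hK,
    fun κ ρ hκ hρ hP' hK hPd hKd => ?_⟩
  rcases hPd with rfl | hPd
  · exact Or.inl (SchurSzego.composition_zero_right d u)
  · exact SchurSzego.nonvanishing_exterior_composition hPd hKd hκ hρ hP' hK
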